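/- Let $(X,d)$ be a compact metric space, let $f\colon X\to X$ be continuous, and let $A\subset X$ be a closed set with $f(A)\subset A$ that contains the measure center of $f$, i.e. the largest set $C\subset X$ such that for every open $U$ with $U\cap C\neq\emptyset$ there is an $f$-invariant Borel probability measure $\mu$ with $\mu(U)>0$. Equip $A$ with the metric $d$. For $S\subset\{0,1,2,\dots\}$ let $\underline d(S)=\liminf_{n\to\infty}\frac1n|S\cap\{0,\dots,n-1\}|$. Let $g\colon Y\to Y$ be a continuous map of a compact metric space $(Y,d)$. For $\alpha\in[0,1)$, $g$ has the $\mathscr M_\alpha$-shadowing property if for every $\varepsilon>0$ there is $\delta>0$ such that for every sequence $(x_i)_{i\ge0}$ in $Y$ with $\lim_{n\to\infty}\frac1n|\{0\le i<n: d(g(x_i),x_{i+1})\ge\delta\}|=0$ there is $z\in Y$ with $\underline d(\{i\ge 0: d(g^i(z),x_i)<\varepsilon\})>\alpha$. The $\underline d$-shadowing property is the $\mathscr M_0$-shadowing property. The map $g$ has the average shadowing property if for every $\varepsilon>0$ there is $\delta>0$ such that for every sequence $(x_i)_{i\ge0}$ in $Y$ for which there is $N>0$ with $\frac1n\sum_{i=0}^{n-1}d(g(x_{i+k}),x_{i+k+1})<\delta$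 for all $n\ge N$ and all $k\ge0$, there is $z\in Y$ with $\limsup_{n\to\infty}\frac1n\sum_{i=0}^{n-1}d(g^i(z),x_i)<\varepsilon$. Then: 1. for every $\alpha\in[0,1)$, if $f|_A\colon A\to A$ has the $\mathscr M_\alpha$-shadowing property, then so does $f$ on $X$ (with the same $\alpha$); 2. if $f|_A$ has the average shadowing property, then so does $f$ on $X$; 3. if $f|_A$ has the $\underline d$-shadowing property, then so does $f$ on $X$. -/

import Mathlib

open Filter Topology MeasureTheory

noncomputable section

namespace Shadowing

/-! ### Invariant measures and the measure center -/

/-- `A` is measure saturated for `f` if every open set meeting `A` has positive measure for some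
`f`-invariant Borel probability measure. -/
def MeasureSaturated {X : Type*} [TopologicalSpace X] [MeasurableSpace X]
    (f : X → X) (A : Set X) : Prop :=
  ∀ U : Set X, IsOpen U → (U ∩ A).Nonempty →
    ∃ μ : Measure X, IsProbabilityMeasure μ ∧ MeasurePreserving f μ μ ∧ 0 < μ U

/-- The measure center of `f`: the largest measure saturated set, which is the union of all of
them (see `isGreatest_measureCenter`). -/
def measureCenter {X : Type*} [TopologicalSpace X] [MeasurableSpace X] (f : X → X) : Set X :=
  ⋃₀ {A | MeasureSaturated f A}

theorem isGreatest_measureCenter {X : Type*} [TopologicalSpace X] [MeasurableSpace X]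
    (f : X → X) : IsGreatest {A | MeasureSaturated f A} (measureCenter f) := by
  refine ⟨?_, fun A hA => Set.subset_sUnion_of_mem hA⟩
  rintro U hU ⟨x, hxU, A, hA, hxA⟩
  exact hA U hU ⟨x, hxU, hxA⟩

/-! ### Lower density -/

/-- `liminf_n |S ∩ {0, ..., n-1}| / n`; the quotients lie in `[0, 1]`. -/
def lowerDensity (S : Set ℕ) : ℝ :=
  liminf (fun n : ℕ => ((S ∩ Set.Iio n).ncard : ℝ) / n) atTop

/-- The family `𝓜_α` of sets of nonnegative integers with lower density greater than `α`. -/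
def lowerDensityFamily (α : ℝ) : Set (Set ℕ) :=
  {S | α < lowerDensity S}

/-! ### Pseudo-orbits and shadowing -/

/-- A `δ`-ergodic pseudo-orbit of `f`: the set of `i` with `d(f(x_i), x_{i+1}) ≥ δ` has
density zero. -/
def IsErgodicPseudoOrbit {X : Type*} [PseudoMetricSpace X] (f : X → X) (δ : ℝ) (x : ℕ → X) :
    Prop :=
  Tendsto (fun n : ℕ => (({i | δ ≤ dist (f (x i)) (x (i + 1))} ∩ Set.Iio n).ncard : ℝ) / n)
    atTop (𝓝 0)

/-- A `δ`-average-pseudo-orbit of `f`. -/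
def IsAveragePseudoOrbit {X : Type*} [PseudoMetricSpace X] (f : X → X) (δ : ℝ) (x : ℕ → X) :
    Prop :=
  ∃ N : ℕ, 0 < N ∧ ∀ n : ℕ, N ≤ n → ∀ k : ℕ,
    (1 / (n : ℝ)) * ∑ i ∈ Finset.range n, dist (f (x (i + k))) (x (i + k + 1)) < δ

/-- The set `Λ(z, x, ε)` of times `i` at which `d(f^i(z), x_i) < ε`. -/
def tracingTimes {X : Type*} [PseudoMetricSpace X] (f : X → X) (z : X) (x : ℕ → X) (ε : ℝ) :
    Set ℕ :=
  {i | dist (f^[i] z) (x i) < ε}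

/-- The (ergodic) `F`-shadowing property for a family `F` of sets of nonnegative integers. -/
def HasFamilyShadowing {X : Type*} [PseudoMetricSpace X] (F : Set (Set ℕ)) (f : X → X) : Prop :=
  ∀ ε : ℝ, 0 < ε → ∃ δ : ℝ, 0 < δ ∧ ∀ x : ℕ → X, IsErgodicPseudoOrbit f δ x →
    ∃ z : X, tracingTimes f z x ε ∈ F

/-- The lower-density shadowing property (`d̲`-shadowing): `F`-shadowing for `F = 𝓜_0`. -/
def HasLowerDensityShadowing {X : Type*} [PseudoMetricSpace X] (f : X → X) : Prop :=
  HasFamilyShadowing (lowerDensityFamily 0) f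

/-- The average shadowing property. On a compact space the averages in the upper limit are
bounded by the diameter of the space, so it is the true upper limit. -/
def HasAverageShadowing {X : Type*} [PseudoMetricSpace X] (f : X → X) : Prop :=
  ∀ ε : ℝ, 0 < ε → ∃ δ : ℝ, 0 < δ ∧ ∀ x : ℕ → X, IsAveragePseudoOrbit f δ x →
    ∃ z : X,
      limsup (fun n : ℕ => (1 / (n : ℝ)) * ∑ i ∈ Finset.range n, dist (f^[i] z) (x i)) atTop < ε

end Shadowing

end

/-!
Write `A` for the closed invariant set containing the measure center. The one place where dynamics
enters is `exists_cesaroMean_infDist_lt`: a long finite pseudo-orbit of small average error is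
close to `A` on average. Otherwise the empirical measures of longer and longer pseudo-orbits, with
average errors tending to zero, would accumulate at a measure that is invariant
(`exists_invariant_limit`) but not carried by `A`, whereas the complement of the measure center is
null for every invariant measure. The same limit shows that `A` is nonempty when `X` is. Replacing
each point of a pseudo-orbit by a nearest point of `A` therefore changes it little on average and
keeps the average errors small (`exists_projection_modulus`).

For average shadowing this is the proof: project the pseudo-orbit to `A`, trace the projection,
and add up the averages.

For lower density above `α` the projection costs a small positive density, which a strict
inequality does not obviously absorb. So suppose `f` fails at precision `ε` for every `δ`, and take
failing pseudo-orbits for `δ = 1 / (k + 1)`. By compactness the failure of all points at once is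
seen at bounded times (`exists_uniform_tracing_failure`), so long initial segments of these
pseudo-orbits can be concatenated to a single sequence that still cannot be traced at precision
`ε / 2` and whose errors now have mean zero (`exists_tendsto_zero_of_not_hasFamilyShadowing`). Its
distance to `A` has mean zero as well, so its projection is an ergodic pseudo-orbit in `A` for
every `δ`; a point tracing the projection at precision `ε / 4` traces the sequence itself at
precision `ε / 2` up to a set of times of density zero, a contradiction.
-/

namespace Shadowing

/-! ### Cesàro means -/

/-- The Cesàro mean `(1/n) ∑_{i < n} u i`, with value `0` at `n = 0`. -/
noncomputable def cesaroMean (u : ℕ → ℝ) (n : ℕ) : ℝ :=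
  (1 / (n : ℝ)) * ∑ i ∈ Finset.range n, u i

theorem cesaroMean_mono {u v : ℕ → ℝ} (h : ∀ i, u i ≤ v i) (n : ℕ) :
    cesaroMean u n ≤ cesaroMean v n :=
  mul_le_mul_of_nonneg_left (Finset.sum_le_sum fun i _ => h i) (by positivity)

theorem cesaroMean_nonneg {u : ℕ → ℝ} (h : ∀ i, 0 ≤ u i) (n : ℕ) : 0 ≤ cesaroMean u n :=
  mul_nonneg (by positivity) (Finset.sum_nonneg fun i _ => h i)

theorem cesaroMean_add (u v : ℕ → ℝ) (n : ℕ) :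
    cesaroMean (fun i => u i + v i) n = cesaroMean u n + cesaroMean v n := by
  simp only [cesaroMean, Finset.sum_add_distrib, mul_add]

theorem cesaroMean_const_mul (c : ℝ) (u : ℕ → ℝ) (n : ℕ) :
    cesaroMean (fun i => c * u i) n = c * cesaroMean u n := by
  simp only [cesaroMean, ← Finset.mul_sum]
  ring

theorem cesaroMean_const_le {c : ℝ} (hc : 0 ≤ c) (n : ℕ) : cesaroMean (fun _ => c) n ≤ c := by
  rcases Nat.eq_zero_or_pos n with rfl | hn
  · simpa [cesaroMean] using hc
  · have : (n : ℝ) ≠ 0 := by positivity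
    simp only [cesaroMean, Finset.sum_const, Finset.card_range, nsmul_eq_mul]
    rw [← mul_assoc, one_div_mul_cancel this, one_mul]

theorem cesaroMean_le_of_le {u : ℕ → ℝ} {c : ℝ} (hc : 0 ≤ c) (h : ∀ i, u i ≤ c) (n : ℕ) :
    cesaroMean u n ≤ c :=
  (cesaroMean_mono h n).trans (cesaroMean_const_le hc n)

theorem cesaroMean_le_add_mul {u v : ℕ → ℝ} {c K : ℝ} (hc : 0 ≤ c)
    (h : ∀ i, u i ≤ c + K * v i) (n : ℕ) :
    cesaroMean u n ≤ c + K * cesaroMean v n := by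
  refine (cesaroMean_mono h n).trans ?_
  rw [cesaroMean_add, cesaroMean_const_mul]
  gcongr
  exact cesaroMean_const_le hc n

theorem abs_cesaroMean_le {u v : ℕ → ℝ} (h : ∀ i, |u i| ≤ v i) (n : ℕ) :
    |cesaroMean u n| ≤ cesaroMean v n := by
  rw [cesaroMean, abs_mul, abs_of_nonneg (by positivity : (0 : ℝ) ≤ 1 / n)]
  exact mul_le_mul_of_nonneg_left
    ((Finset.abs_sum_le_sum_abs _ _).trans (Finset.sum_le_sum fun i _ => h i)) (by positivity)

/-- Means over a window and over the window shifted by one differ by a boundary term. -/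
theorem abs_cesaroMean_succ_sub_le {u : ℕ → ℝ} {C : ℝ} (h : ∀ i, |u i| ≤ C) (n : ℕ) :
    |cesaroMean (fun i => u (i + 1)) n - cesaroMean u n| ≤ 2 * C / n := by
  have hs : ∑ i ∈ Finset.range n, u (i + 1) - ∑ i ∈ Finset.range n, u i = u n - u 0 := by
    rw [← Finset.sum_sub_distrib, Finset.sum_range_sub]
  rw [cesaroMean, cesaroMean, ← mul_sub, hs, abs_mul,
    abs_of_nonneg (by positivity : (0 : ℝ) ≤ 1 / n), one_div_mul_eq_div]
  gcongr
  have := abs_sub (u n) (u 0)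
  linarith [h n, h 0]

/-- If the Cesàro means of `v` tend to zero and `u ≤ c + K v` for every `c > 0` and some
`K = K(c)`, then the Cesàro means of `u` tend to zero. -/
theorem tendsto_cesaroMean_zero {ι : Type*} {F : Filter ι} {u v : ι → ℕ → ℝ} {n : ι → ℕ}
    (hu : ∀ k i, 0 ≤ u k i)
    (hv : Tendsto (fun k => cesaroMean (v k) (n k)) F (𝓝 0))
    (h : ∀ c : ℝ, 0 < c → ∃ K : ℝ, 0 ≤ K ∧ ∀ k i, u k i ≤ c + K * v k i) :
    Tendsto (fun k => cesaroMean (u k) (n k)) F (𝓝 0) := by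
  refine tendsto_order.2 ⟨fun a ha => Eventually.of_forall fun k =>
    ha.trans_le (cesaroMean_nonneg (hu k) _), fun a ha => ?_⟩
  obtain ⟨K, hK, hle⟩ := h (a / 2) (by positivity)
  have hlim : Tendsto (fun k => a / 2 + K * cesaroMean (v k) (n k)) F (𝓝 (a / 2 + K * 0)) :=
    (hv.const_mul K).const_add _
  filter_upwards [hlim.eventually_lt_const (by linarith : a / 2 + K * 0 < a)] with k hk
  exact (cesaroMean_le_add_mul (by positivity) (hle k) _).trans_lt hk

/-- A uniformly continuous function with bounded range has a modulus of continuity that is affine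
with arbitrarily small constant term; such a modulus passes through averages. -/
theorem exists_affine_modulus {X Y : Type*} [PseudoMetricSpace X] [CompactSpace X]
    [PseudoMetricSpace Y] {g : X → Y} (hg : Continuous g) {c : ℝ} (hc : 0 < c) :
    ∃ K : ℝ, 0 ≤ K ∧ ∀ u v, dist (g u) (g v) ≤ c + K * dist u v := by
  obtain ⟨r, hr, hgr⟩ :=
    Metric.uniformContinuous_iff.1 (CompactSpace.uniformContinuous_of_continuous hg) c hc
  obtain ⟨C, hC⟩ := Metric.isBounded_range_iff.1 (isCompact_range hg).isBounded
  refine ⟨max C 0 / r, by positivity, fun u v => ?_⟩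
  rcases lt_or_ge (dist u v) r with h | h
  · have : 0 ≤ max C 0 / r * dist u v := by positivity
    linarith [hgr h]
  · calc dist (g u) (g v) ≤ max C 0 := (hC u v).trans (le_max_left _ _)
      _ = max C 0 / r * r := by field_simp
      _ ≤ max C 0 / r * dist u v := by gcongr
      _ ≤ _ := by linarith

/-! ### Invariant measures as limits of empirical measures -/

theorem measure_compl_eq_zero_of_measureCenter_subset {X : Type*} [TopologicalSpace X]
    [SecondCountableTopology X] [MeasurableSpace X] {f : X → X} {A : Set X}
    (hcenter : measureCenter f ⊆ A) {μ : Measure X} [IsProbabilityMeasure μ]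
    (hμ : MeasurePreserving f μ μ) : μ Aᶜ = 0 := by
  refine measure_null_of_locally_null _ fun y hy => ?_
  have hsat : ¬ MeasureSaturated f {y} := fun h => hy (hcenter ⟨{y}, h, rfl⟩)
  simp only [MeasureSaturated, not_forall] at hsat
  obtain ⟨U, hU, hyU, hno⟩ := hsat
  obtain ⟨w, hwU, rfl⟩ := hyU
  refine ⟨U, mem_nhdsWithin_of_mem_nhds (hU.mem_nhds hwU), ?_⟩
  by_contra h
  exact hno ⟨μ, inferInstance, hμ, pos_iff_ne_zero.2 h⟩

section Measure

variable {X : Type*} [MetricSpace X] [CompactSpace X] [MeasurableSpace X] [BorelSpace X]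

/-- The empirical measure of `x 0, ..., x n`, as a probability measure. -/
noncomputable def empiricalMeasure (x : ℕ → X) (n : ℕ) : ProbabilityMeasure X :=
  ⟨((n + 1 : ℕ) : ENNReal)⁻¹ • ∑ i ∈ Finset.range (n + 1), Measure.dirac (x i), ⟨by
    simp only [Measure.smul_apply, Measure.finsetSum_apply, measure_univ, Finset.sum_const,
      Finset.card_range, smul_eq_mul, nsmul_eq_mul, mul_one]
    exact ENNReal.inv_mul_cancel (by simp) (by simp)⟩⟩

theorem integral_empiricalMeasure (x : ℕ → X) (n : ℕ) (g : X → ℝ) :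
    ∫ y, g y ∂(empiricalMeasure x n : Measure X) = cesaroMean (fun i => g (x i)) (n + 1) := by
  change ∫ y, g y ∂(((n + 1 : ℕ) : ENNReal)⁻¹ •
    ∑ i ∈ Finset.range (n + 1), Measure.dirac (x i)) = _
  rw [integral_smul_measure, integral_finsetSum_measure fun i _ => integrable_dirac (by simp)]
  simp only [cesaroMean, integral_dirac, ENNReal.toReal_inv, ENNReal.toReal_natCast, smul_eq_mul,
    one_div]

/-- Empirical measures along longer and longer finite pseudo-orbits whose average error tends to
zero accumulate at an invariant measure. -/
theorem exists_invariant_limit {f : X → X} (hf : Continuous f) (x : ℕ → ℕ → X) {n : ℕ → ℕ}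
    (hn : Tendsto n atTop atTop)
    (hx : Tendsto (fun k => cesaroMean (fun i => dist (f (x k i)) (x k (i + 1))) (n k + 1))
      atTop (𝓝 0)) :
    ∃ (μ : Measure X) (F : Filter ℕ), IsProbabilityMeasure μ ∧ MeasurePreserving f μ μ ∧
      F.NeBot ∧ F ≤ atTop ∧ ∀ g : X → ℝ, Continuous g →
        Tendsto (fun k => cesaroMean (fun i => g (x k i)) (n k + 1)) F (𝓝 (∫ y, g y ∂μ)) := by
  let F : Ultrafilter ℕ := Ultrafilter.of atTop
  have hF : (F : Filter ℕ) ≤ atTop := Ultrafilter.of_le _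
  obtain ⟨μ, -, hμ⟩ := isCompact_univ.ultrafilter_le_nhds
    (F.map fun k => empiricalMeasure (x k) (n k)) (by simp)
  have hlim : ∀ g : X → ℝ, Continuous g →
      Tendsto (fun k => cesaroMean (fun i => g (x k i)) (n k + 1)) F
        (𝓝 (∫ y, g y ∂(μ : Measure X))) := by
    intro g hg
    have := ProbabilityMeasure.tendsto_iff_forall_integral_tendsto.1
      (show Tendsto (fun k => empiricalMeasure (x k) (n k)) F (𝓝 μ) from hμ)
      (BoundedContinuousFunction.mkOfCompact ⟨g, hg⟩)
    simpa [integral_empiricalMeasure] using this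
  refine ⟨μ, F, inferInstance, ⟨hf.measurable, ?_⟩, inferInstance, hF, hlim⟩
  have : IsProbabilityMeasure (Measure.map f (μ : Measure X)) :=
    Measure.isProbabilityMeasure_map hf.measurable.aemeasurable
  refine ext_of_forall_integral_eq_of_IsFiniteMeasure fun g => ?_
  rw [integral_map hf.measurable.aemeasurable g.continuous.aestronglyMeasurable]
  have hgf : Continuous fun y => g (f y) := g.continuous.comp hf
  refine tendsto_nhds_unique (hlim _ hgf) ?_
  -- The mean of `g (f (x i))` is close to that of `g (x (i + 1))`, hence to that of `g (x i)`.
  have h1 : Tendsto (fun k => cesaroMean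
      (fun i => dist (g (f (x k i))) (g (x k (i + 1)))) (n k + 1)) F (𝓝 0) := by
    refine tendsto_cesaroMean_zero (fun _ _ => dist_nonneg) (hx.mono_left hF) fun c hc => ?_
    obtain ⟨K, hK, h⟩ := exists_affine_modulus g.continuous hc
    exact ⟨K, hK, fun k i => h _ _⟩
  have h2 : Tendsto (fun k => 2 * ‖g‖ / ((n k + 1 : ℕ) : ℝ)) F (𝓝 0) :=
    (tendsto_const_nhds.div_atTop (tendsto_natCast_atTop_atTop.comp
      ((tendsto_add_atTop_nat 1).comp hn))).mono_left hF
  have h3 : Tendsto (fun k => cesaroMean (fun i => g (f (x k i))) (n k + 1) -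
      cesaroMean (fun i => g (x k i)) (n k + 1)) F (𝓝 0) := by
    refine squeeze_zero_norm (fun k => ?_) (by simpa only [add_zero] using h1.add h2)
    have e : cesaroMean (fun i => g (f (x k i))) (n k + 1) =
        cesaroMean (fun i => g (f (x k i)) - g (x k (i + 1))) (n k + 1) +
          cesaroMean (fun i => g (x k (i + 1))) (n k + 1) := by
      rw [← cesaroMean_add]
      simp
    have b1 := abs_cesaroMean_le (u := fun i => g (f (x k i)) - g (x k (i + 1)))
      (fun i => (Real.dist_eq _ _).ge) (n k + 1)
    have b2 := abs_cesaroMean_succ_sub_le (u := fun i => g (x k i)) (C := ‖g‖)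
      (fun i => g.norm_coe_le_norm _) (n k + 1)
    rw [Real.norm_eq_abs, e, add_sub_assoc]
    exact (abs_add_le _ _).trans (add_le_add b1 b2)
  simpa using (hlim _ g.continuous).add h3

theorem nonempty_of_measureCenter_subset [Nonempty X] {f : X → X} (hf : Continuous f) {A : Set X}
    (hcenter : measureCenter f ⊆ A) : A.Nonempty := by
  obtain ⟨y⟩ := ‹Nonempty X›
  obtain ⟨μ, -, hμ, hinv, -⟩ := exists_invariant_limit hf (fun _ i => f^[i] y) tendsto_id
    (by simp [Function.iterate_succ_apply', cesaroMean])
  by_contra hA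
  have := measure_compl_eq_zero_of_measureCenter_subset hcenter hinv
  simp [Set.not_nonempty_iff_eq_empty.1 hA] at this

/-- A long finite pseudo-orbit of small average error is close on average to any set containing
the measure center. -/
theorem exists_cesaroMean_infDist_lt {f : X → X} (hf : Continuous f) {A : Set X}
    (hcenter : measureCenter f ⊆ A) {η : ℝ} (hη : 0 < η) :
    ∃ δ : ℝ, 0 < δ ∧ ∃ N : ℕ, ∀ x : ℕ → X, ∀ n : ℕ, N ≤ n →
      cesaroMean (fun i => dist (f (x i)) (x (i + 1))) n < δ →
      cesaroMean (fun i => Metric.infDist (x i) A) n < η := by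
  by_contra! hcon
  choose x n hn herr hfar using fun k : ℕ => hcon (1 / (k + 1)) (by positivity) (k + 1)
  have hsucc : ∀ k, n k - 1 + 1 = n k := fun k => by have := hn k; omega
  obtain ⟨μ, F, hμ, hinv, hF, -, hlim⟩ := exists_invariant_limit hf x (n := fun k => n k - 1)
    (tendsto_atTop_mono (fun k => by have := hn k; show k ≤ _; omega) tendsto_id) (by
      simp only [hsucc]
      exact squeeze_zero (fun k => cesaroMean_nonneg (fun _ => dist_nonneg) _)
        (fun k => (herr k).le) tendsto_one_div_add_atTop_nhds_zero_nat)
  have h0 : ∫ y, Metric.infDist y A ∂μ = 0 := by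
    refine integral_eq_zero_of_ae ?_
    have hA : ∀ᵐ y ∂μ, y ∈ A := measure_compl_eq_zero_of_measureCenter_subset hcenter hinv
    filter_upwards [hA] with y hy
    simpa using Metric.infDist_zero_of_mem hy
  have := ge_of_tendsto (hlim _ (Metric.continuous_infDist_pt A))
    (Eventually.of_forall fun k => by simpa only [hsucc] using hfar k)
  linarith

end Measure

/-! ### Projecting pseudo-orbits to a closed invariant set -/

/-- The errors of the nearest-point projection of a pseudo-orbit to an invariant set `A` are
controlled by the original errors and the distance to `A`. -/
theorem exists_projection_modulus {X : Type*} [MetricSpace X] [CompactSpace X] {f : X → X}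
    (hf : Continuous f) {A : Set X} (hinv : Set.MapsTo f A A) {p : X → A}
    (hp : ∀ u, Metric.infDist u A = dist u (p u)) {c : ℝ} (hc : 0 < c) :
    ∃ K : ℝ, 0 ≤ K ∧ ∀ u v,
      dist (f (p u)) (p v) ≤ c + K * (Metric.infDist u A + dist (f u) v) := by
  obtain ⟨K, hK, h⟩ := exists_affine_modulus hf (half_pos hc)
  refine ⟨2 * K + 2, by positivity, fun u v => ?_⟩
  have h1 : dist (f u) (f (p u)) ≤ c / 2 + K * Metric.infDist u A := by
    rw [hp]; exact h _ _
  -- As `f (p u) ∈ A`, the distance from `v` to `A` is at most that from `v` to `f (p u)`.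
  have h2 : dist v (p v) ≤ dist v (f u) + dist (f u) (f (p u)) := by
    rw [← hp]
    exact (Metric.infDist_le_dist_of_mem (hinv (p u).2)).trans (dist_triangle _ _ _)
  have h3 : dist (f (p u)) (p v) ≤ dist (f (p u)) (f u) + dist (f u) v + dist v (p v) :=
    dist_triangle4 _ _ _ _
  rw [dist_comm v (f u)] at h2
  rw [dist_comm (f (p u)) (f u)] at h3
  nlinarith [mul_nonneg hK (dist_nonneg (x := f u) (y := v)),
    Metric.infDist_nonneg (x := u) (s := A)]

theorem exists_nearest_point {X : Type*} [MetricSpace X] [CompactSpace X] {A : Set X}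
    (hA : IsClosed A) (hne : A.Nonempty) :
    ∃ p : X → A, ∀ u, Metric.infDist u A = dist u (p u) := by
  choose p hpA hp using fun u => hA.exists_infDist_eq_dist hne u
  exact ⟨fun u => ⟨p u, hpA u⟩, hp⟩

/-! ### Average shadowing -/

theorem HasAverageShadowing.of_restrict {X : Type*} [MetricSpace X] [CompactSpace X]
    [MeasurableSpace X] [BorelSpace X] {f : X → X} (hf : Continuous f) {A : Set X}
    (hA : IsClosed A) (hinv : Set.MapsTo f A A) (hcenter : measureCenter f ⊆ A)
    (h : HasAverageShadowing (hinv.restrict f A A)) : HasAverageShadowing f := by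
  intro ε hε
  rcases isEmpty_or_nonempty X with hX | hX
  · exact ⟨1, one_pos, fun x => isEmptyElim (x 0)⟩
  obtain ⟨p, hp⟩ := exists_nearest_point hA (nonempty_of_measureCenter_subset hf hcenter)
  obtain ⟨δ', hδ', htrace⟩ := h (ε / 2) (by positivity)
  obtain ⟨K, hK, hmod⟩ := exists_projection_modulus hf hinv hp (half_pos hδ')
  have hη : 0 < δ' / (4 * (K + 1)) := by positivity
  obtain ⟨δ, hδ, N₀, hclose⟩ := exists_cesaroMean_infDist_lt hf hcenter
    (lt_min hη (by positivity : 0 < ε / 4))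
  refine ⟨min δ (δ' / (4 * (K + 1))), lt_min hδ hη, fun x hx => ?_⟩
  obtain ⟨N, hN, hx⟩ := hx
  have herr : ∀ n, N ≤ n → ∀ k, cesaroMean
      (fun i => dist (f (x (i + k))) (x (i + 1 + k))) n < min δ (δ' / (4 * (K + 1))) := by
    intro n hn k
    simpa only [cesaroMean, add_right_comm] using hx n hn k
  have hdist : ∀ n, max N N₀ ≤ n → ∀ k, cesaroMean
      (fun i => Metric.infDist (x (i + k)) A) n < min (δ' / (4 * (K + 1))) (ε / 4) := fun n hn k =>
    hclose (fun i => x (i + k)) n (le_of_max_le_right hn)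
      ((herr n (le_of_max_le_left hn) k).trans_le (min_le_left _ _))
  obtain ⟨z, hz⟩ := htrace (fun i => p (x i)) ⟨max N N₀, lt_max_of_lt_left hN, fun n hn k => by
    have h1 := (herr n (le_of_max_le_left hn) k).trans_le (min_le_right _ _)
    have h2 := (hdist n hn k).trans_le (min_le_left _ _)
    have h3 := cesaroMean_le_add_mul (half_pos hδ').le
      (fun i => hmod (x (i + k)) (x (i + 1 + k))) n
    rw [cesaroMean_add] at h3
    have h4 : K * (cesaroMean (fun i => Metric.infDist (x (i + k)) A) n +
        cesaroMean (fun i => dist (f (x (i + k))) (x (i + 1 + k))) n) ≤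
          K * (δ' / (4 * (K + 1)) + δ' / (4 * (K + 1))) := by gcongr
    have h5 : K * (δ' / (4 * (K + 1)) + δ' / (4 * (K + 1))) < δ' / 2 := by
      have : K * (δ' / (4 * (K + 1)) + δ' / (4 * (K + 1))) = δ' / 2 * (K / (K + 1)) := by
        field_simp; ring
      rw [this]
      exact mul_lt_of_lt_one_right (by positivity) ((div_lt_one (by positivity)).2 (by linarith))
    have h6 : cesaroMean (fun i => dist (f (p (x (i + k)))) (p (x (i + 1 + k)))) n < δ' := by
      linarith
    simpa only [cesaroMean, add_right_comm, Subtype.dist_eq, Set.MapsTo.val_restrict_apply]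
      using h6⟩
  obtain ⟨D, hD⟩ := Metric.isBounded_iff.1 (isCompact_univ (X := X)).isBounded
  replace hD : ∀ u v : X, dist u v ≤ D := fun u v => hD (Set.mem_univ u) (Set.mem_univ v)
  have hD0 : 0 ≤ D := dist_nonneg.trans (hD (x 0) (x 0))
  refine ⟨z, ?_⟩
  have hev := eventually_lt_of_limsup_lt hz (isBoundedUnder_of ⟨D, fun n =>
    cesaroMean_le_of_le hD0 (fun i => hD _ _) n⟩)
  refine (limsup_le_of_le (a := 3 * ε / 4) (isCoboundedUnder_le_of_le _ (x := 0) fun n =>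
    cesaroMean_nonneg (fun _ => dist_nonneg) n) ?_).trans_lt (by linarith)
  filter_upwards [hev, eventually_ge_atTop (max N N₀)] with n hn hnN
  have h1 := (hdist n hnN 0).trans_le (min_le_right _ _)
  have h2 : cesaroMean (fun i => dist (f^[i] z) (x i)) n ≤
      cesaroMean (fun i => dist (f^[i] z) (p (x i)) + Metric.infDist (x (i + 0)) A) n := by
    refine cesaroMean_mono (fun i => ?_) n
    rw [add_zero, hp, dist_comm (x i)]
    exact dist_triangle _ _ _
  rw [cesaroMean_add] at h2
  have h3 : cesaroMean (fun i => dist (f^[i] z) (p (x i))) n < ε / 2 := by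
    simpa only [cesaroMean, Subtype.dist_eq, Set.MapsTo.coe_iterate_restrict] using hn
  change cesaroMean (fun i => dist (f^[i] z) (x i)) n ≤ _
  linarith

/-! ### Densities as Cesàro means -/

theorem ncard_inter_Iio_div (S : Set ℕ) (n : ℕ) :
    ((S ∩ Set.Iio n).ncard : ℝ) / n = cesaroMean (S.indicator 1) n := by
  classical
  have : S ∩ Set.Iio n = ((Finset.range n).filter (· ∈ S) : Finset ℕ) := by
    ext i; simp [and_comm]
  rw [this, Set.ncard_coe_finset, cesaroMean, one_div_mul_eq_div, Finset.card_filter]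
  simp [Set.indicator_apply]

theorem lowerDensity_eq (S : Set ℕ) :
    lowerDensity S = liminf (cesaroMean (S.indicator 1)) atTop := by
  simp only [lowerDensity, ncard_inter_Iio_div]

theorem indicator_one_nonneg (S : Set ℕ) (i : ℕ) : (0 : ℝ) ≤ S.indicator 1 i :=
  Set.indicator_nonneg (fun _ _ => zero_le_one) i

theorem indicator_one_le_one (S : Set ℕ) (i : ℕ) : S.indicator (1 : ℕ → ℝ) i ≤ 1 :=
  Set.indicator_le_self' (fun _ _ => zero_le_one) i

theorem exists_eventually_lt_of_lt_lowerDensity {S : Set ℕ} {α : ℝ} (h : α < lowerDensity S) :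
    ∃ β, α < β ∧ ∀ᶠ n in atTop, β < cesaroMean (S.indicator 1) n := by
  obtain ⟨β, hαβ, hβ⟩ := exists_between h
  rw [lowerDensity_eq] at hβ
  exact ⟨β, hαβ, eventually_lt_of_lt_liminf hβ (isBoundedUnder_of ⟨0, fun n =>
    cesaroMean_nonneg (indicator_one_nonneg S) n⟩)⟩

theorem frequently_lt_of_lowerDensity_lt {S : Set ℕ} {β : ℝ} (h : lowerDensity S < β) :
    ∃ᶠ n in atTop, cesaroMean (S.indicator 1) n < β := by
  rw [lowerDensity_eq] at h
  exact frequently_lt_of_liminf_lt (isCoboundedUnder_ge_of_le _ (x := 1) fun n =>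
    cesaroMean_le_of_le zero_le_one (indicator_one_le_one S) n) h

/-- The lower density does not decrease when `S` loses only a set of density zero. -/
theorem lt_lowerDensity_of_indicator_le {S S' : Set ℕ} {α : ℝ} (h : α < lowerDensity S)
    {v : ℕ → ℝ} (hv : Tendsto (cesaroMean v) atTop (𝓝 0))
    (hle : ∀ i, S.indicator (1 : ℕ → ℝ) i ≤ S'.indicator 1 i + v i) : α < lowerDensity S' := by
  obtain ⟨β, hαβ, hβ⟩ := exists_eventually_lt_of_lt_lowerDensity h
  refine (show α < (α + β) / 2 by linarith).trans_le ?_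
  rw [lowerDensity_eq]
  refine le_liminf_of_le (isCoboundedUnder_ge_of_le _ (x := 1) fun n =>
    cesaroMean_le_of_le zero_le_one (indicator_one_le_one S') n) ?_
  filter_upwards [hβ, hv.eventually_lt_const (by linarith : 0 < (β - α) / 2)] with n h1 h2
  have := cesaroMean_mono hle n
  rw [cesaroMean_add] at this
  linarith

theorem isErgodicPseudoOrbit_iff {X : Type*} [PseudoMetricSpace X] {f : X → X} {δ : ℝ}
    {x : ℕ → X} : IsErgodicPseudoOrbit f δ x ↔
      Tendsto (cesaroMean ({i | δ ≤ dist (f (x i)) (x (i + 1))}.indicator 1)) atTop (𝓝 0) := by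
  simp only [IsErgodicPseudoOrbit, ncard_inter_Iio_div]

theorem IsErgodicPseudoOrbit.of_tendsto_cesaroMean {X : Type*} [PseudoMetricSpace X] {f : X → X}
    {δ : ℝ} (hδ : 0 < δ) {x : ℕ → X}
    (hx : Tendsto (cesaroMean fun i => dist (f (x i)) (x (i + 1))) atTop (𝓝 0)) :
    IsErgodicPseudoOrbit f δ x := by
  refine isErgodicPseudoOrbit_iff.2 (tendsto_cesaroMean_zero (n := id)
    (fun _ => indicator_one_nonneg _) hx fun c hc => ⟨1 / δ, by positivity, fun _ i => ?_⟩)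
  have h0 : 0 ≤ 1 / δ * dist (f (x i)) (x (i + 1)) := by positivity
  refine Set.indicator_apply_le' (fun hi => ?_) fun _ => by positivity
  have : 1 ≤ 1 / δ * dist (f (x i)) (x (i + 1)) := by
    rw [one_div_mul_eq_div, one_le_div hδ]
    exact hi
  simp only [Pi.one_apply]
  linarith

theorem IsErgodicPseudoOrbit.eventually_cesaroMean_lt {X : Type*} [PseudoMetricSpace X]
    {f : X → X} {δ D : ℝ} (hδ : 0 < δ) (hD : ∀ u v : X, dist u v ≤ D) {x : ℕ → X}
    (hx : IsErgodicPseudoOrbit f δ x) :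
    ∀ᶠ n in atTop, cesaroMean (fun i => dist (f (x i)) (x (i + 1))) n < 2 * δ := by
  have hlim := ((isErgodicPseudoOrbit_iff.1 hx).const_mul D).const_add δ
  filter_upwards [hlim.eventually_lt_const (by linarith : δ + D * 0 < 2 * δ)] with n hn
  refine (cesaroMean_le_add_mul hδ.le (fun i => ?_) n).trans_lt hn
  by_cases hi : i ∈ {i | δ ≤ dist (f (x i)) (x (i + 1))}
  · rw [Set.indicator_of_mem hi]
    simp only [Pi.one_apply, mul_one]
    linarith [hD (f (x i)) (x (i + 1))]
  · rw [Set.indicator_of_notMem hi, mul_zero, add_zero]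
    exact (not_le.1 hi).le

/-- If no point traces `x` with lower density above `α`, then the times at which the tracing
frequency drops below a given `β > α` are bounded uniformly in the tracing point, at the price of
halving the precision. -/
theorem exists_uniform_tracing_failure {X : Type*} [PseudoMetricSpace X] [CompactSpace X]
    {f : X → X} (hf : Continuous f) {x : ℕ → X} {ε α β : ℝ} (hε : 0 < ε)
    (hx : ∀ z, lowerDensity (tracingTimes f z x ε) ≤ α) (hαβ : α < β) (T : ℕ) :
    ∃ L : ℕ, ∀ w, ∃ t, T ≤ t ∧ t ≤ L ∧
      cesaroMean ((tracingTimes f w x (ε / 2)).indicator 1) t < β := by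
  have hfail : ∀ z, ∃ t, T ≤ t ∧ cesaroMean ((tracingTimes f z x ε).indicator 1) t < β :=
    fun z => frequently_atTop.1 (frequently_lt_of_lowerDensity_lt ((hx z).trans_lt hαβ)) T
  choose t hT ht using hfail
  have hnhds : ∀ z, {w | ∀ i ∈ Finset.range (t z), dist (f^[i] w) (f^[i] z) < ε / 2} ∈ 𝓝 z := by
    intro z
    refine (Finset.eventually_all _).2 fun i _ => ?_
    exact (hf.iterate i).continuousAt.eventually (Metric.ball_mem_nhds _ (half_pos hε))
  obtain ⟨s, hs⟩ := CompactSpace.elim_nhds_subcover _ hnhds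
  refine ⟨s.sup t, fun w => ?_⟩
  obtain ⟨z, hz, hw⟩ := Set.mem_iUnion₂.1 (hs.ge (Set.mem_univ w))
  refine ⟨t z, hT z, Finset.le_sup hz, lt_of_le_of_lt ?_ (ht z)⟩
  refine mul_le_mul_of_nonneg_left (Finset.sum_le_sum fun i hi => ?_) (by positivity)
  refine Set.indicator_apply_le' (fun hwi => ?_) fun _ => indicator_one_nonneg _ i
  have hwi' : dist (f^[i] w) (x i) < ε / 2 := hwi
  have : i ∈ tracingTimes f z x ε := by
    have h1 := dist_triangle_left (f^[i] z) (x i) (f^[i] w)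
    have h2 := hw i hi
    show dist _ _ < _
    linarith
  rw [Set.indicator_of_mem this]

/-! ### Concatenating pseudo-orbits -/

/-- The index of the interval `[m k, m (k + 1))` that contains `i`. -/
noncomputable def blockIndex (m : ℕ → ℕ) (i : ℕ) : ℕ :=
  open Classical in Nat.findGreatest (fun k => m k ≤ i) i

theorem blockIndex_eq {m : ℕ → ℕ} (hm : StrictMono m) {k i : ℕ} (h : m k ≤ i)
    (h' : i < m (k + 1)) : blockIndex m i = k := by
  classical
  refine Nat.findGreatest_eq_iff.2 ⟨(hm.id_le k).trans h, fun _ => h, fun n hn _ => ?_⟩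
  exact not_le.2 (h'.trans_le (hm.monotone hn))

theorem exists_block {m : ℕ → ℕ} (hm : StrictMono m) {j n : ℕ} (h : m j ≤ n) :
    ∃ k, j ≤ k ∧ m k ≤ n ∧ n < m (k + 1) := by
  classical
  have hex : ∃ k, n < m (k + 1) := ⟨n, (Nat.lt_succ_self n).trans_le (hm.id_le _)⟩
  have hmin : ∀ k < Nat.find hex, m (k + 1) ≤ n := fun k hk => not_lt.1 (Nat.find_min hex hk)
  have hj : j ≤ Nat.find hex := by
    by_contra! hlt
    exact absurd (Nat.find_spec hex) (not_lt.2 ((hm.monotone hlt).trans h))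
  refine ⟨Nat.find hex, hj, ?_, Nat.find_spec hex⟩
  rcases Nat.eq_zero_or_pos (Nat.find hex) with h0 | h0
  · rw [h0] at hj ⊢
    rwa [Nat.le_zero.1 hj] at h
  · have := hmin (Nat.find hex - 1) (by omega)
    rwa [Nat.sub_add_cancel h0] at this

/-- The sequence equal on each interval `[m k, m (k + 1))` to an initial segment of `x k`. -/
noncomputable def concat {X : Type*} (x : ℕ → ℕ → X) (m : ℕ → ℕ) (i : ℕ) : X :=
  x (blockIndex m i) (i - m (blockIndex m i))

theorem concat_add {X : Type*} {x : ℕ → ℕ → X} {m : ℕ → ℕ} (hm : StrictMono m) {k t : ℕ}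
    (h : m k + t < m (k + 1)) : concat x m (m k + t) = x k t := by
  rw [concat, blockIndex_eq hm (Nat.le_add_right _ _) h, Nat.add_sub_cancel_left]

/-- Along one block the total error of the concatenation grows like that of the block, up to one
jump at its end. -/
theorem sum_error_concat_le {X : Type*} [PseudoMetricSpace X] {f : X → X} {D : ℝ}
    (hD : ∀ u v : X, dist u v ≤ D) {x : ℕ → ℕ → X} {m : ℕ → ℕ} (hm : StrictMono m) {k t : ℕ}
    (h : m k + t ≤ m (k + 1)) :
    ∑ i ∈ Finset.range (m k + t), dist (f (concat x m i)) (concat x m (i + 1)) ≤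
      ∑ i ∈ Finset.range (m k), dist (f (concat x m i)) (concat x m (i + 1)) +
        ∑ i ∈ Finset.range t, dist (f (x k i)) (x k (i + 1)) + D := by
  have hD0 : 0 ≤ D := dist_nonneg.trans (hD (x 0 0) (x 0 0))
  rw [Finset.sum_range_add, add_assoc]
  gcongr
  rcases Nat.eq_zero_or_pos t with rfl | ht
  · simpa using hD0
  obtain ⟨t, rfl⟩ := Nat.exists_eq_succ_of_ne_zero ht.ne'
  rw [Nat.succ_eq_add_one, Finset.sum_range_succ, Finset.sum_range_succ, add_assoc]
  have h1 : ∑ i ∈ Finset.range t, dist (f (concat x m (m k + i))) (concat x m (m k + i + 1)) =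
      ∑ i ∈ Finset.range t, dist (f (x k i)) (x k (i + 1)) := by
    refine Finset.sum_congr rfl fun i hi => ?_
    have hi := Finset.mem_range.1 hi
    rw [concat_add hm (by omega), add_assoc, concat_add hm (by omega)]
  rw [h1]
  have h2 := hD (f (concat x m (m k + t))) (concat x m (m k + t + 1))
  have h3 : 0 ≤ dist (f (x k t)) (x k (t + 1)) := dist_nonneg
  rw [← add_assoc (m k)]
  linarith

/-- Pseudo-orbits whose average errors tend to zero can be concatenated, with blocks as long as
desired, to a sequence with errors of mean zero: each block is taken so long that it outweighs
all that precedes it and the initial part of the next block. -/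
theorem exists_concat {X : Type*} [PseudoMetricSpace X] {f : X → X} {D : ℝ}
    (hD : ∀ u v : X, dist u v ≤ D) (x : ℕ → ℕ → X)
    (hx : ∀ k : ℕ, ∀ᶠ n in atTop,
      cesaroMean (fun i => dist (f (x k i)) (x k (i + 1))) n < 2 * (1 / ((k : ℝ) + 1)))
    (L : ℕ → ℕ → ℕ) :
    ∃ m : ℕ → ℕ, StrictMono m ∧ (∀ k, m k + L k (m k) < m (k + 1)) ∧
      Tendsto (cesaroMean fun i => dist (f (concat x m i)) (concat x m (i + 1))) atTop (𝓝 0) := by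
  have hD0 : 0 ≤ D := dist_nonneg.trans (hD (x 0 0) (x 0 0))
  have hB : ∀ k : ℕ, ∃ B : ℝ, 0 ≤ B ∧ ∀ t : ℕ,
      ∑ i ∈ Finset.range t, dist (f (x k i)) (x k (i + 1)) ≤ 2 / ((k : ℝ) + 1) * t + B := by
    intro k
    obtain ⟨C, hC⟩ := eventually_atTop.1 (hx k)
    refine ⟨C * D, by positivity, fun t => ?_⟩
    rcases le_total C t with h | h
    · have h1 := hC t h
      rcases Nat.eq_zero_or_pos t with rfl | ht
      · simp only [Finset.range_zero, Finset.sum_empty]; positivity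
      have ht' : (0 : ℝ) < t := by exact_mod_cast ht
      rw [cesaroMean, one_div_mul_eq_div, div_lt_iff₀ ht', ← mul_div_assoc, mul_one] at h1
      have : 0 ≤ C * D := by positivity
      linarith
    · have h1 : ∑ i ∈ Finset.range t, dist (f (x k i)) (x k (i + 1)) ≤ t * D := by
        simpa using Finset.sum_le_card_nsmul (Finset.range t) _ D fun i _ => hD _ _
      have h2 : (t : ℝ) * D ≤ C * D := by gcongr
      have h3 : 0 ≤ 2 / ((k : ℝ) + 1) * t := by positivity
      linarith
  choose B hB0 hB using hB
  -- The length of block `k` when it starts at time `n`.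
  let len : ℕ → ℕ → ℕ := fun k n =>
    L k n + 1 + ⌈((k : ℝ) + 1) * (n * D + B k + D + B (k + 1) + D)⌉₊
  obtain ⟨m, hmsucc⟩ : ∃ m : ℕ → ℕ, ∀ k, m (k + 1) = m k + len k (m k) :=
    ⟨fun k => Nat.rec 0 (fun k n => n + len k n) k, fun _ => rfl⟩
  have hm : StrictMono m := strictMono_nat_of_lt_succ fun k => by
    rw [hmsucc]; simp only [len]; omega
  refine ⟨m, hm, fun k => by rw [hmsucc]; simp only [len]; omega, ?_⟩
  have hlen : ∀ k : ℕ, ((k : ℝ) + 1) * (m k * D + B k + D + B (k + 1) + D) ≤ len k (m k) := by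
    intro k
    exact (Nat.le_ceil _).trans (Nat.cast_le.2 (Nat.le_add_left _ _))
  set S : ℕ → ℝ := fun n =>
    ∑ i ∈ Finset.range n, dist (f (concat x m i)) (concat x m (i + 1)) with hS
  have hstep : ∀ k t : ℕ, m k + t ≤ m (k + 1) →
      S (m k + t) ≤ S (m k) + (2 / ((k : ℝ) + 1) * t + B k) + D := fun k t h => by
    have := sum_error_concat_le (f := f) hD (x := x) hm h
    have := hB k t
    simp only [hS]
    linarith
  have hmain : ∀ k n : ℕ, m (k + 1) ≤ n → n < m (k + 2) → S n ≤ 3 / ((k : ℝ) + 1) * n := by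
    intro k n h1 h2
    obtain ⟨t, rfl⟩ := Nat.exists_eq_add_of_le h1
    have e1 := hstep (k + 1) t h2.le
    have e2 := hstep k (len k (m k)) (hmsucc k).ge
    rw [← hmsucc] at e2
    have e3 : S (m k) ≤ m k * D := by
      simpa using Finset.sum_le_card_nsmul (Finset.range (m k))
        (fun i => dist (f (concat x m i)) (concat x m (i + 1))) D fun i _ => hD _ _
    have e4 : m k * D + B k + D + B (k + 1) + D ≤ 1 / ((k : ℝ) + 1) * len k (m k) := by
      rw [one_div_mul_eq_div, le_div_iff₀ (by positivity), mul_comm]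
      exact hlen k
    have e5 : 2 / (((k + 1 : ℕ) : ℝ) + 1) * t ≤ 3 / ((k : ℝ) + 1) * t := by
      gcongr
      · norm_num
      · linarith
    have e6 : 3 / ((k : ℝ) + 1) * ((m (k + 1) + t : ℕ) : ℝ) =
        3 / ((k : ℝ) + 1) * m k + (2 / ((k : ℝ) + 1) * len k (m k) +
          1 / ((k : ℝ) + 1) * len k (m k)) + 3 / ((k : ℝ) + 1) * t := by
      rw [hmsucc]; push_cast; ring
    have e7 : 0 ≤ 3 / ((k : ℝ) + 1) * m k := by positivity
    rw [e6]
    linarith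
  refine tendsto_order.2 ⟨fun a ha => Eventually.of_forall fun n =>
    ha.trans_le (cesaroMean_nonneg (fun _ => dist_nonneg) _), fun a ha => ?_⟩
  obtain ⟨k₀, hk₀⟩ := exists_nat_gt (3 / a)
  filter_upwards [eventually_ge_atTop (m (k₀ + 1)), eventually_gt_atTop 0] with n hn hn0
  obtain ⟨j, hj, h1, h2⟩ := exists_block hm hn
  obtain ⟨k, rfl⟩ := Nat.exists_eq_succ_of_ne_zero (by omega : j ≠ 0)
  have hn0' : (0 : ℝ) < n := by exact_mod_cast hn0
  have hk : (k₀ : ℝ) ≤ k := by exact_mod_cast Nat.le_of_succ_le_succ hj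
  rw [cesaroMean, one_div_mul_eq_div, div_lt_iff₀ hn0']
  refine (hmain k n h1 h2).trans_lt ?_
  gcongr
  rw [div_lt_iff₀ (by positivity)]
  rw [div_lt_iff₀ ha] at hk₀
  nlinarith

/-! ### Lower density shadowing -/

/-- A failure of shadowing with lower density above `α` for arbitrarily fine pseudo-orbits is
witnessed by one sequence whose errors have mean zero. -/
theorem exists_tendsto_zero_of_not_hasFamilyShadowing {X : Type*} [MetricSpace X] [CompactSpace X]
    {f : X → X} (hf : Continuous f) {ε α : ℝ} (hε : 0 < ε) (hα : 0 ≤ α)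
    (hfail : ∀ δ : ℝ, 0 < δ → ∃ x : ℕ → X, IsErgodicPseudoOrbit f δ x ∧
      ∀ z, lowerDensity (tracingTimes f z x ε) ≤ α) :
    ∃ x : ℕ → X, Tendsto (cesaroMean fun i => dist (f (x i)) (x (i + 1))) atTop (𝓝 0) ∧
      ∀ z, lowerDensity (tracingTimes f z x (ε / 2)) ≤ α := by
  obtain ⟨D, hD⟩ := Metric.isBounded_iff.1 (isCompact_univ (X := X)).isBounded
  replace hD : ∀ u v : X, dist u v ≤ D := fun u v => hD (Set.mem_univ u) (Set.mem_univ v)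
  choose x hx hno using fun k : ℕ => hfail (1 / ((k : ℝ) + 1)) (by positivity)
  -- Block `k` is long enough to contain a failure time that dwarfs the start `n` of the block.
  choose L hL using fun k n : ℕ => exists_uniform_tracing_failure hf hε (hno k)
    (show α < α + 1 / ((k : ℝ) + 1) by linarith [show 0 < 1 / ((k : ℝ) + 1) by positivity])
    ((k + 1) * n + k + 1)
  obtain ⟨m, hm, hmL, hlim⟩ := exists_concat (f := f) hD x
    (fun k => (hx k).eventually_cesaroMean_lt (by positivity) hD) L
  refine ⟨concat x m, hlim, fun z => ?_⟩
  by_contra! hz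
  obtain ⟨β, hαβ, hβ⟩ := exists_eventually_lt_of_lt_lowerDensity hz
  obtain ⟨N, hN⟩ := eventually_atTop.1 hβ
  obtain ⟨k₀, hk₀⟩ := exists_nat_gt (2 / (β - α))
  let k := max N k₀
  obtain ⟨t, hTt, htL, ht⟩ := hL k (m k) (f^[m k] z)
  have hmt := hN (m k + t) (by have : N ≤ k := le_max_left _ _; omega)
  have hkR : (0 : ℝ) < (k : ℝ) + 1 := by positivity
  have ht0 : (0 : ℝ) < t := by exact_mod_cast (show 0 < t by omega)
  have hmt0 : (0 : ℝ) < ((m k + t : ℕ) : ℝ) := by push_cast; positivity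
  rw [cesaroMean, one_div_mul_eq_div, lt_div_iff₀ hmt0, Finset.sum_range_add] at hmt
  rw [cesaroMean, one_div_mul_eq_div, div_lt_iff₀ ht0] at ht
  have h1 : ∑ i ∈ Finset.range (m k),
      (tracingTimes f z (concat x m) (ε / 2)).indicator (1 : ℕ → ℝ) i ≤ m k := by
    simpa using Finset.sum_le_card_nsmul (Finset.range (m k)) _ 1 fun i _ =>
      indicator_one_le_one _ i
  have h2 : ∑ i ∈ Finset.range t,
      (tracingTimes f z (concat x m) (ε / 2)).indicator (1 : ℕ → ℝ) (m k + i) =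
      ∑ i ∈ Finset.range t, (tracingTimes f (f^[m k] z) (x k) (ε / 2)).indicator 1 i := by
    refine Finset.sum_congr rfl fun i hi => ?_
    have hi := Finset.mem_range.1 hi
    have hlt : m k + i < m (k + 1) := by have := hmL k; omega
    classical
    simp only [Set.indicator_apply, tracingTimes, Set.mem_ofPred_eq, concat_add hm hlt,
      ← Function.iterate_add_apply, add_comm i, Pi.one_apply]
  have h3 : (m k : ℝ) ≤ 1 / ((k : ℝ) + 1) * t := by
    rw [one_div_mul_eq_div, le_div_iff₀ hkR, mul_comm]
    exact_mod_cast (show (k + 1) * m k ≤ t by omega)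
  have h4 : 2 / ((k : ℝ) + 1) < β - α := by
    have : (k₀ : ℝ) ≤ k := by exact_mod_cast le_max_right _ _
    rw [div_lt_iff₀ (by linarith)] at hk₀
    rw [div_lt_iff₀ hkR]
    nlinarith
  have h5 : β * t ≤ β * ((m k + t : ℕ) : ℝ) := by
    have : 0 ≤ β := hα.trans hαβ.le
    gcongr
    exact_mod_cast Nat.le_add_left _ _
  have h6 : 2 / ((k : ℝ) + 1) * t = 1 / ((k : ℝ) + 1) * t + 1 / ((k : ℝ) + 1) * t := by ring
  nlinarith [mul_lt_mul_of_pos_right h4 ht0]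

theorem HasFamilyShadowing.of_restrict {X : Type*} [MetricSpace X] [CompactSpace X]
    [MeasurableSpace X] [BorelSpace X] {f : X → X} (hf : Continuous f) {A : Set X}
    (hA : IsClosed A) (hinv : Set.MapsTo f A A) (hcenter : measureCenter f ⊆ A)
    {α : ℝ} (hα : 0 ≤ α)
    (h : HasFamilyShadowing (lowerDensityFamily α) (hinv.restrict f A A)) :
    HasFamilyShadowing (lowerDensityFamily α) f := by
  intro ε hε
  by_contra! hcon
  obtain ⟨x, hx, hno⟩ := exists_tendsto_zero_of_not_hasFamilyShadowing hf hε hα fun δ hδ => by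
    obtain ⟨x, hx, hno⟩ := hcon δ hδ
    exact ⟨x, hx, fun z => not_lt.1 (hno z)⟩
  have : Nonempty X := ⟨x 0⟩
  obtain ⟨p, hp⟩ := exists_nearest_point hA (nonempty_of_measureCenter_subset hf hcenter)
  have hdist : Tendsto (cesaroMean fun i => Metric.infDist (x i) A) atTop (𝓝 0) := by
    refine tendsto_order.2 ⟨fun a ha => Eventually.of_forall fun n =>
      ha.trans_le (cesaroMean_nonneg (fun _ => Metric.infDist_nonneg) _), fun a ha => ?_⟩
    obtain ⟨δ, hδ, N, hclose⟩ := exists_cesaroMean_infDist_lt hf hcenter ha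
    filter_upwards [hx.eventually_lt_const hδ, eventually_ge_atTop N] with n h1 h2
    exact hclose x n h2 h1
  have hproj : Tendsto (cesaroMean fun i => dist (f (p (x i))) (p (x (i + 1)))) atTop (𝓝 0) := by
    have hsum := hdist.add hx
    simp only [← cesaroMean_add, add_zero] at hsum
    refine tendsto_cesaroMean_zero (n := id) (u := fun _ i => dist (f (p (x i))) (p (x (i + 1))))
      (fun _ _ => dist_nonneg) hsum fun c hc => ?_
    obtain ⟨K, hK, hmod⟩ := exists_projection_modulus hf hinv hp hc
    exact ⟨K, hK, fun _ i => hmod _ _⟩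
  obtain ⟨δ, hδ, htrace⟩ := h (ε / 4) (by positivity)
  obtain ⟨z, hz⟩ := htrace (fun i => p (x i)) (.of_tendsto_cesaroMean hδ (by
    simpa only [Subtype.dist_eq, Set.MapsTo.val_restrict_apply] using hproj))
  have hv : Tendsto (cesaroMean fun i => 4 / ε * Metric.infDist (x i) A) atTop (𝓝 0) := by
    have := hdist.const_mul (4 / ε)
    simp only [← cesaroMean_const_mul, mul_zero] at this
    exact this
  -- `z` traces `x` to within `ε / 2` when it traces the projection to within `ε / 4`, except at
  -- times when `x` is at distance at least `ε / 4` from `A`; these have density zero.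
  refine (hno z).not_gt (lt_lowerDensity_of_indicator_le hz hv fun i => ?_)
  have h0 : 0 ≤ 4 / ε * Metric.infDist (x i) A := mul_nonneg (by positivity) Metric.infDist_nonneg
  have h1 := indicator_one_nonneg (tracingTimes f z x (ε / 2)) i
  refine Set.indicator_apply_le' (fun hi => ?_) fun _ => by positivity
  rcases lt_or_ge (Metric.infDist (x i) A) (ε / 4) with hlt | hge
  · have hi' : dist (f^[i] z) (p (x i)) < ε / 4 := by
      simpa only [tracingTimes, Set.mem_ofPred_eq, Subtype.dist_eq,
        Set.MapsTo.coe_iterate_restrict] using hi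
    have hmem : i ∈ tracingTimes f z x (ε / 2) := by
      rw [hp] at hlt
      have := dist_triangle_right (f^[i] z) (x i) (p (x i))
      show dist _ _ < _
      linarith
    rw [Set.indicator_of_mem hmem]
    linarith
  · have : 1 ≤ 4 / ε * Metric.infDist (x i) A := by
      rw [div_mul_eq_mul_div, one_le_div hε]
      linarith
    simp only [Pi.one_apply]
    linarith

end Shadowing

theorem theorem7p2 {X : Type*} [MetricSpace X] [CompactSpace X] [MeasurableSpace X] [BorelSpace X]
    (f : X → X) (hf : Continuous f)
    (A : Set X) (hA : IsClosed A) (hinv : Set.MapsTo f A A)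
    (hcenter : Shadowing.measureCenter f ⊆ A) :
    (∀ α : ℝ, 0 ≤ α → α < 1 →
      Shadowing.HasFamilyShadowing (Shadowing.lowerDensityFamily α) (hinv.restrict f A A) →
      Shadowing.HasFamilyShadowing (Shadowing.lowerDensityFamily α) f) ∧
    (Shadowing.HasAverageShadowing (hinv.restrict f A A) → Shadowing.HasAverageShadowing f) ∧
    (Shadowing.HasLowerDensityShadowing (hinv.restrict f A A) →
      Shadowing.HasLowerDensityShadowing f) :=
  ⟨fun _ hα _ h => .of_restrict hf hA hinv hcenter hα h,
    fun h => .of_restrict hf hA hinv hcenter h,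
    fun h => Shadowing.HasFamilyShadowing.of_restrict hf hA hinv hcenter le_rfl h⟩
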